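/- Let $E:\mathbb{R}^D\to\mathbb{R}$ be smooth ($C^\infty$) and let $n\ge 0$. A modified vector field of order $n$ for gradient descent on $E$ is a vector field of the form $\tilde f_h=f_0+hf_1+\dots+h^nf_n$, with smooth vector fields $f_0,\dots,f_n:\mathbb{R}^D\to\mathbb{R}^D$ that do not depend on $h$, such that for every $\theta_0\in\mathbb{R}^D$ and all sufficiently small $h>0$ the solution of $\dot\theta=\tilde f_h(\theta)$, $\theta(0)=\theta_0$, exists on $[0,h]$ and satisfies $$\bigl\|\theta(h)-\bigl(\theta_0-h\nabla E(\theta_0)\bigr)\bigr\|=O(h^{n+2})\qquad(h\to0^+),$$ where the implied constant may depend on $\theta_0$. By a term we mean a formal expression built recursively as follows: for $m\ge 0$ and terms $\tau_1,\dots,\tau_m$, the expression $\nabla^{m+1}E\,(\tau_1,\dots,\tau_m,\cdot)$ is a term (the derivative tensor of order $m+1$ with $m$ slots filled with terms and one slot left free, so that it is a vector; $m=0$ gives $\nabla E$). A term is non-principal if at least one derivative of $E$ of order at least $3$ occurs in it. Theorem. There are formal finite real linear combinations $C_0,C_1,C_2,\dots$ of non-principal terms, independent of $E$, $D$, $n$,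 $h$ and $\theta$, such that for every $n\ge0$, every $D$ and every smooth $E:\mathbb{R}^D\to\mathbb{R}$ there is exactly one modified vector field of order $n$ for gradient descent on $E$ (that is, exactly one choice of $f_0,\dots,f_n$), and it is $$\tilde f_h(\theta)=\sum_{p=0}^{n}\frac{-1}{p+1}\,h^p\,\bigl(\nabla^2E(\theta)\bigr)^p\,\nabla E(\theta)\;+\;\sum_{p=0}^{n}h^p\,C_p[E](\theta),$$ where $C_p[E]$ is the vector field that $C_p$ denotes for $E$. -/

import Mathlib

open scoped ContDiff

noncomputable section

/-- The parameter space `ℝ^D` with its Euclidean inner product. -/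
abbrev Param (D : ℕ) : Type := EuclideanSpace ℝ (Fin D)

/-- The Hessian `∇²E(θ)` as a linear operator on `ℝ^D`: the Jacobian of the gradient. -/
def hessian {D : ℕ} (E : Param D → ℝ) (θ : Param D) : Param D →L[ℝ] Param D :=
  fderiv ℝ (gradient E) θ

/-- `γ` solves the autonomous equation `θ' = F θ` on the time interval `[0, T]`, with
`θ(0) = θ₀`. -/
def IsSolution {D : ℕ} (F : Param D → Param D) (θ₀ : Param D) (T : ℝ) (γ : ℝ → Param D) : Prop :=
  γ 0 = θ₀ ∧ ∀ t ∈ Set.Icc (0 : ℝ) T, HasDerivWithinAt γ (F (γ t)) (Set.Icc (0 : ℝ) T) t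

/-- The vector field `f₀ + h f₁ + ⋯ + hⁿ fₙ`. -/
def truncatedField {D n : ℕ} (f : Fin (n + 1) → Param D → Param D) (h : ℝ) (θ : Param D) :
    Param D :=
  ∑ p : Fin (n + 1), h ^ (p : ℕ) • f p θ

/-- `f₀ + h f₁ + ⋯ + hⁿ fₙ`, with smooth `f₀, …, fₙ` that do not depend on `h`, is the modified
vector field of order `n` of gradient descent on `E`: from every starting point `θ₀`, and for every
small learning rate `h > 0`, its flow exists up to time `h` and its value at time `h` is the
gradient descent update `θ₀ - h ∇E(θ₀)` up to an error `O(h^(n+2))`. -/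
structure IsModifiedField {D : ℕ} (n : ℕ) (E : Param D → ℝ)
    (f : Fin (n + 1) → Param D → Param D) : Prop where
  smooth : ∀ p, ContDiff ℝ ∞ (f p)
  error : ∀ θ₀ : Param D, ∃ K : ℝ, ∃ h₀ > 0, ∀ h : ℝ, 0 < h → h < h₀ →
    (∃ γ, IsSolution (truncatedField f h) θ₀ h γ) ∧
    ∀ γ, IsSolution (truncatedField f h) θ₀ h γ →
      ‖γ h - (θ₀ - h • gradient E θ₀)‖ ≤ K * h ^ (n + 2)

/-- Formal terms built from the derivatives of an unspecified function `E`: `node m c` is the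
derivative tensor `∇^(m+1) E`, with `m` of its slots filled with the terms `c 0, …, c (m-1)`. The
remaining slot makes it a vector. So `node 0` is `∇E`, `node 1` is `∇²E` applied to a term, and
so on. -/
inductive DerivTerm : Type
  | node (m : ℕ) (c : Fin m → DerivTerm) : DerivTerm

/-- The vector field that a formal term denotes for a given function `E`. The tensor `∇^(m+1) E`,
with one slot left free, is the `m`-th derivative of the gradient. -/
def DerivTerm.eval {D : ℕ} (E : Param D → ℝ) : DerivTerm → Param D → Param D
  | .node m c => fun θ => iteratedFDeriv ℝ m (gradient E) θ (fun i => (c i).eval E θ)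

/-- The term contains a derivative of `E` of order at least three. -/
def DerivTerm.HasHigherDeriv : DerivTerm → Prop
  | .node m c => 3 ≤ m + 1 ∨ ∃ i, (c i).HasHigherDeriv

/-- A formal finite linear combination, with real coefficients, of terms. The terms and the
coefficients do not depend on `E`, on `θ` or on the dimension. -/
abbrev DerivExpr : Type := DerivTerm →₀ ℝ

/-- The vector field that a formal linear combination of terms denotes for a given `E`. -/
def DerivExpr.eval {D : ℕ} (E : Param D → ℝ) (e : DerivExpr) (θ : Param D) : Param D :=
  e.sum fun τ a => a • τ.eval E θ

/-- The expression is a sum of terms each of which contains a derivative of `E` of order at least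
three (a non-principal expression). -/
def DerivExpr.IsNonPrincipal (e : DerivExpr) : Prop :=
  ∀ τ ∈ e.support, τ.HasHigherDeriv

end

/-! By Taylor expansion, the time-`h` flow of `∑ hᵖ f p` has as its `h^(q+1)` coefficient `stepCoeff
lieDeriv f q`, a combination of iterated derivatives of the fields along each other. This is `f q`
plus an expression in earlier coefficients. Requiring the step `-h ∇E` up to `O(h^(n+2))` is
therefore a triangular system with exactly one solution, `modSeq` (`isModifiedField_iff`,
`eq_modSeq`).

The recursion needs only a vector space and an operation "derivative along", so it can be run once
on formal terms. Linear maps that respect the operation carry solutions to solutions (`map_modSeq`),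
and two such maps are used. Evaluation at `E` gives the actual fields
(`DerivExpr.evalₗ_derivAlong`). The map `principal` keeps only the terms `(∇²E)^k ∇E`, recorded as
`X^k`. A derivative falling on a Hessian creates a third derivative, so only the one falling on the
innermost gradient survives, and the operation becomes `(p, q) ↦ X p q` (`principal_derivAlong`).

In this commutative model iterated derivatives are powers. With `z = hX` the step condition reads
`exp (z g(z)) = 1 - z`, so `g(z) = log (1 - z) / z = -∑ z^p / (p + 1)`. These are the principal
coefficients; what remains of the formal solution is non-principal. -/

noncomputable section

open Finset

/-! ### The formal recursion for an arbitrary operation -/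

section IteratedOperation

variable {V W : Type*} [AddCommGroup V] [AddCommGroup W]

/-- For the formal series `∑ hⁱ f i` and an operation `op a b`, read as the derivative of `b`
along `a`, the coefficient of `h ^ j` in the `k`-fold derivative of the series along itself. -/
def iterDeriv (op : V → V → V) (f : ℕ → V) : ℕ → ℕ → V
  | 0, j => f j
  | k + 1, j => ∑ p ∈ antidiagonal j, op (f p.2) (iterDeriv op f k p.1)

theorem iterDeriv_congr (op : V → V → V) {f g : ℕ → V} (k : ℕ) :
    ∀ {j : ℕ}, (∀ i ≤ j, f i = g i) → iterDeriv op f k j = iterDeriv op g k j := by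
  induction k with
  | zero => intro j h; exact h j le_rfl
  | succ k ih =>
    intro j h
    refine sum_congr rfl fun p hp => ?_
    have hp' := mem_antidiagonal.1 hp
    rw [h p.2 (by omega), ih fun i hi => h i (by omega)]

variable [Module ℝ V] [Module ℝ W]

/-- The coefficient of `h ^ (q + 1)` in the time-`h` flow of the series `∑ hⁱ f i`. -/
def stepCoeff (op : V → V → V) (f : ℕ → V) (q : ℕ) : V :=
  ∑ k ∈ range (q + 1), (1 / ((k + 1).factorial : ℝ)) • iterDeriv op f k (q - k)

/-- The coefficients of the series whose time-`h` flow moves by `h b`, without terms of higher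
order. -/
def modSeq (op : V → V → V) (b : V) (q : ℕ) : V :=
  (if q = 0 then b else 0) - ∑ k ∈ range q, (1 / ((k + 2).factorial : ℝ)) •
    iterDeriv op (fun i => if _h : i < q then modSeq op b i else 0) (k + 1) (q - 1 - k)
termination_by q

/-- The summand `k = 0` is `f q`; the others involve only `f i` with `i < q`. This triangular form
gives existence and uniqueness of the solution. -/
theorem stepCoeff_eq (op : V → V → V) (f : ℕ → V) (q : ℕ) :
    stepCoeff op f q = f q + ∑ k ∈ range q, (1 / ((k + 2).factorial : ℝ)) •
      iterDeriv op f (k + 1) (q - 1 - k) := by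
  rw [stepCoeff, sum_range_succ', add_comm]
  congr 1
  · simp [iterDeriv]
  · refine sum_congr rfl fun k _ => ?_
    rw [show q - (k + 1) = q - 1 - k by omega]

theorem stepCoeff_congr (op : V → V → V) {f g : ℕ → V} {q : ℕ} (h : ∀ i ≤ q, f i = g i) :
    stepCoeff op f q = stepCoeff op g q :=
  sum_congr rfl fun k _ => by rw [iterDeriv_congr op k fun i hi => h i (by omega)]

theorem stepCoeff_modSeq (op : V → V → V) (b : V) (q : ℕ) :
    stepCoeff op (modSeq op b) q = if q = 0 then b else 0 := by
  rw [stepCoeff_eq, modSeq, sub_add, sub_eq_self, sub_eq_zero]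
  refine sum_congr rfl fun k hk => ?_
  have hk' := mem_range.1 hk
  congr 1
  -- Only indices at most `q - 1 - k` occur, so the cut-off that makes `modSeq` well-founded changes
  -- nothing.
  refine iterDeriv_congr op _ fun i hi => ?_
  rw [dif_pos (by omega)]

theorem eq_modSeq (op : V → V → V) (b : V) {f : ℕ → V} {n : ℕ}
    (h : ∀ q ≤ n, stepCoeff op f q = if q = 0 then b else 0) :
    ∀ q ≤ n, f q = modSeq op b q := by
  intro q
  induction q using Nat.strong_induction_on with
  | _ q ih =>
    intro hq
    have h1 := h q hq
    rw [← stepCoeff_modSeq op b q, stepCoeff_eq, stepCoeff_eq] at h1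
    refine add_right_cancel (h1.trans ?_)
    congr 1
    refine sum_congr rfl fun k hk => ?_
    have hk' := mem_range.1 hk
    congr 1
    exact iterDeriv_congr op _ fun i hi => (ih i (by omega) (by omega)).symm

theorem map_iterDeriv {op : V → V → V} {op' : W → W → W} (φ : V →ₗ[ℝ] W)
    (hφ : ∀ a b, φ (op a b) = op' (φ a) (φ b)) (f : ℕ → V) (k : ℕ) :
    ∀ j, φ (iterDeriv op f k j) = iterDeriv op' (fun i => φ (f i)) k j := by
  induction k with
  | zero => intro j; rfl
  | succ k ih => intro j; simp only [iterDeriv, map_sum, hφ, ih]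

theorem map_stepCoeff {op : V → V → V} {op' : W → W → W} (φ : V →ₗ[ℝ] W)
    (hφ : ∀ a b, φ (op a b) = op' (φ a) (φ b)) (f : ℕ → V) (q : ℕ) :
    φ (stepCoeff op f q) = stepCoeff op' (fun i => φ (f i)) q := by
  simp only [stepCoeff, map_sum, map_smul, map_iterDeriv φ hφ]

/-- The image sequence satisfies the transported step conditions, whose solution is unique. -/
theorem map_modSeq {op : V → V → V} {op' : W → W → W} (φ : V →ₗ[ℝ] W)
    (hφ : ∀ a b, φ (op a b) = op' (φ a) (φ b)) (b : V) (q : ℕ) :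
    φ (modSeq op b q) = modSeq op' (φ b) q := by
  refine eq_modSeq (n := q) op' (φ b) (f := fun i => φ (modSeq op b i)) (fun i _ => ?_) q le_rfl
  rw [← map_stepCoeff φ hφ, stepCoeff_modSeq]
  split_ifs <;> simp

end IteratedOperation

/-! ### The principal coefficients: the logarithm series -/

section LogSeries

/-- The power series `log (1 - z) / z`. -/
def logQuotient : PowerSeries ℝ := PowerSeries.mk fun i => -1 / ((i : ℝ) + 1)

/-- The partial sums of `exp (log (1 - z))`. -/
def expPartial (N : ℕ) : PowerSeries ℝ :=
  ∑ k ∈ range N, (1 / (k.factorial : ℝ)) • (PowerSeries.X * logQuotient) ^ k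

open PowerSeries in
theorem one_sub_X_mul_derivative_log :
    (1 - X) * d⁄dX ℝ (X * logQuotient) = (-1 : PowerSeries ℝ) := by
  have h : d⁄dX ℝ (X * logQuotient) = -(PowerSeries.mk 1 : PowerSeries ℝ) := by
    ext m
    rw [coeff_derivative, coeff_succ_X_mul, logQuotient, coeff_mk, map_neg, coeff_mk]
    have : (m : ℝ) + 1 ≠ 0 := by positivity
    field_simp
    simp
  rw [h, mul_neg, mul_comm, PowerSeries.mk_one_mul_one_sub_eq_one]

open PowerSeries in
theorem one_sub_X_mul_derivative_expPartial (N : ℕ) :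
    (1 - X) * d⁄dX ℝ (expPartial (N + 1)) = -expPartial N := by
  have h (k : ℕ) : (1 - X) * d⁄dX ℝ ((1 / ((k + 1).factorial : ℝ)) • (X * logQuotient) ^ (k + 1)) =
      -((1 / (k.factorial : ℝ)) • (X * logQuotient) ^ k) := by
    rw [Derivation.map_smul, Derivation.leibniz_pow, Nat.add_sub_cancel, mul_smul_comm,
      mul_smul_comm, smul_eq_mul, mul_left_comm, one_sub_X_mul_derivative_log, mul_neg, mul_one,
      ← Nat.cast_smul_eq_nsmul ℝ, smul_smul, smul_neg]
    congr 2
    have : (k.factorial : ℝ) ≠ 0 := by positivity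
    have : (k : ℝ) + 1 ≠ 0 := by positivity
    rw [Nat.factorial_succ]
    push_cast
    field_simp
  rw [expPartial, sum_range_succ', map_add, map_sum, mul_add, mul_sum]
  simp only [h]
  simp [expPartial]

-- The series `y = 1 - z` is determined by `(1 - z) y' = -y` and `y(0) = 1`. The partial sums
-- satisfy this equation with a shift in `N`, which is invisible in degrees below `N`.
open PowerSeries in
theorem coeff_expPartial (N m : ℕ) (h : m ≤ N) :
    coeff m (expPartial (N + 1)) = if m = 0 then 1 else if m = 1 then -1 else 0 := by
  have hlow : ∀ j < N, coeff j (expPartial N) = coeff j (expPartial (N + 1)) := by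
    intro j hj
    rw [expPartial, expPartial, sum_range_succ, map_add, left_eq_add, mul_pow, coeff_smul,
      coeff_X_pow_mul', if_neg (by omega), smul_zero]
  induction m with
  | zero =>
    rw [expPartial, sum_range_succ', map_add, map_sum]
    simp
  | succ m ih =>
    have h1 := congrArg (coeff m) (one_sub_X_mul_derivative_expPartial N)
    have h2 := ih (by omega)
    rw [sub_mul, one_mul, map_sub, coeff_derivative, map_neg, hlow m (by omega), h2] at h1
    rcases m with _ | m
    · simpa using h1
    · rw [coeff_succ_X_mul, coeff_derivative, h2] at h1
      have : ((m + 1 : ℕ) : ℝ) + 1 ≠ 0 := by positivity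
      rw [if_neg (by omega), if_neg (by omega)]
      rcases m with _ | m
      · simp at h1; linarith
      · simp at h1
        rcases h1 with h1 | h1
        · exact h1
        · exfalso; apply this; push_cast; linarith

open Polynomial in
theorem iterDeriv_polynomial (a : PowerSeries ℝ) (k : ℕ) : ∀ j,
    iterDeriv (fun p q : ℝ[X] => X * p * q) (fun i => C (PowerSeries.coeff i a) * X ^ i) k j =
      C (PowerSeries.coeff j (a ^ (k + 1))) * X ^ (j + k) := by
  induction k with
  | zero => intro j; simp [iterDeriv]
  | succ k ih =>
    intro j
    rw [iterDeriv, pow_succ a, PowerSeries.coeff_mul, map_sum, sum_mul]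
    refine sum_congr rfl fun p hp => ?_
    rw [ih, ← mem_antidiagonal.1 hp, map_mul]
    ring

-- Up to a factor `X`, the step conditions are the coefficients of `exp (log (1 - z)) = 1 - z` in
-- positive degree; `-1` is the coefficient of `z`.
open Polynomial in
theorem modSeq_polynomial (q : ℕ) :
    modSeq (fun p q : ℝ[X] => X * p * q) (-1) q = C (-1 / ((q : ℝ) + 1)) * X ^ q := by
  symm
  refine eq_modSeq (n := q) _ _ (f := fun i => C (-1 / ((i : ℝ) + 1)) * X ^ i) (fun m _ => ?_) q
    le_rfl
  have hf : (fun i : ℕ => C (-1 / ((i : ℝ) + 1)) * X ^ i) =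
      fun i => C (PowerSeries.coeff i logQuotient) * X ^ i := by
    simp [logQuotient]
  have h1 := coeff_expPartial (m + 1) (m + 1) le_rfl
  rw [expPartial, sum_range_succ', map_add, map_sum] at h1
  rw [hf, stepCoeff]
  have h2 : ∀ k ∈ range (m + 1), (1 / ((k + 1).factorial : ℝ)) •
      iterDeriv (fun p q : ℝ[X] => X * p * q)
        (fun i => C (PowerSeries.coeff i logQuotient) * X ^ i) k (m - k) =
      C (PowerSeries.coeff (m + 1) ((1 / ((k + 1).factorial : ℝ)) •
        (PowerSeries.X * logQuotient) ^ (k + 1))) * X ^ m := by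
    intro k hk
    have hk' := mem_range.1 hk
    rw [iterDeriv_polynomial, mul_pow, PowerSeries.coeff_smul, PowerSeries.coeff_X_pow_mul',
      if_pos (by omega), show m - k + k = m by omega, show m + 1 - (k + 1) = m - k by omega,
      smul_eq_mul, map_mul, smul_eq_C_mul, mul_assoc]
  rw [sum_congr rfl h2, ← sum_mul, ← map_sum]
  -- The constant term of the exponential does not reach degree `m + 1`.
  have h3 : PowerSeries.coeff (m + 1) ((1 / ((0 : ℕ).factorial : ℝ)) •
      (PowerSeries.X * logQuotient) ^ 0) = 0 := by
    simp [PowerSeries.coeff_one]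
  rw [h3, add_zero] at h1
  rw [h1]
  rcases m with _ | m <;> simp

end LogSeries

/-! ### Formal terms and chains of Hessians -/

namespace DerivTerm

/-- The formal derivative of a term along a term. -/
def derivAlong (σ : DerivTerm) : DerivTerm → DerivExpr
  | .node m c => Finsupp.single (.node (m + 1) (Fin.cons σ c)) 1 +
      ∑ i, Finsupp.mapDomain (fun τ => .node m (Function.update c i τ)) (derivAlong σ (c i))

/-- The term `(∇²E)^k ∇E`. -/
def chain : ℕ → DerivTerm
  | 0 => .node 0 Fin.elim0
  | k + 1 => .node 1 fun _ => chain k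

open Polynomial in
/-- `X ^ k` for the term `(∇²E)^k ∇E`, and zero for the non-principal terms. -/
def chainPoly : DerivTerm → ℝ[X]
  | .node 0 _ => 1
  | .node 1 c => X * (c 0).chainPoly
  | .node (_ + 2) _ => 0

open Polynomial in
theorem chainPoly_chain (k : ℕ) : (chain k).chainPoly = X ^ k := by
  induction k with
  | zero => simp [chain, chainPoly]
  | succ k ih => rw [chain, chainPoly, ih, pow_succ']

theorem chainPoly_eq_zero : ∀ {τ : DerivTerm}, τ.HasHigherDeriv → τ.chainPoly = 0
  | .node 0 c, h => by simp [HasHigherDeriv] at h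
  | .node 1 c, h => by
    have h0 : (c 0).HasHigherDeriv := by simpa [HasHigherDeriv] using h
    rw [chainPoly, chainPoly_eq_zero h0, mul_zero]
  | .node (m + 2) c, _ => by rw [chainPoly]

theorem exists_eq_chain : ∀ {τ : DerivTerm}, ¬ τ.HasHigherDeriv → ∃ k, τ = chain k
  | .node 0 c, _ => ⟨0, by rw [chain, Subsingleton.elim c]⟩
  | .node 1 c, h => by
    have h0 : ¬ (c 0).HasHigherDeriv := by simpa [HasHigherDeriv] using h
    obtain ⟨k, hk⟩ := exists_eq_chain h0
    refine ⟨k + 1, ?_⟩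
    rw [chain, ← hk]
    congr 1
    funext i
    rw [Subsingleton.elim i 0]
  | .node (m + 2) c, h => by simp [HasHigherDeriv] at h

theorem not_hasHigherDeriv_chain (k : ℕ) : ¬ (chain k).HasHigherDeriv := fun h => by
  have := chainPoly_eq_zero h
  rw [chainPoly_chain] at this
  exact pow_ne_zero k Polynomial.X_ne_zero this

theorem chain_injective : Function.Injective chain := fun k l h => by
  have := congrArg chainPoly h
  rw [chainPoly_chain, chainPoly_chain] at this
  simpa using congrArg Polynomial.natDegree this

end DerivTerm

/-! ### Formal expressions and their principal part -/

namespace DerivExpr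

/-- The formal derivative of the second expression along the first. -/
def derivAlong (a b : DerivExpr) : DerivExpr :=
  b.sum fun τ t => a.sum fun σ s => (s * t) • σ.derivAlong τ

/-- A linear map of formal expressions that turns derivatives of terms into a bilinear operation
turns derivatives of expressions into this operation. -/
theorem linearCombination_derivAlong {W : Type*} [AddCommGroup W] [Module ℝ W]
    {v : DerivTerm → W} {op : W → W → W}
    (hterm : ∀ σ τ, Finsupp.linearCombination ℝ v (DerivTerm.derivAlong σ τ) = op (v σ) (v τ))
    (hop : ∀ a b : DerivExpr, op (Finsupp.linearCombination ℝ v a) (Finsupp.linearCombination ℝ v b)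
      = b.sum fun τ t => a.sum fun σ s => (s * t) • op (v σ) (v τ))
    (a b : DerivExpr) :
    Finsupp.linearCombination ℝ v (derivAlong a b) =
      op (Finsupp.linearCombination ℝ v a) (Finsupp.linearCombination ℝ v b) := by
  rw [hop, derivAlong, Finsupp.sum, Finsupp.sum, map_sum]
  refine sum_congr rfl fun τ _ => ?_
  rw [Finsupp.sum, Finsupp.sum, map_sum]
  refine sum_congr rfl fun σ _ => ?_
  rw [map_smul, hterm]

open Polynomial in
/-- The coefficients of the principal terms of an expression. -/
def principal : DerivExpr →ₗ[ℝ] ℝ[X] :=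
  Finsupp.linearCombination ℝ DerivTerm.chainPoly

-- Differentiating an outer Hessian gives a `node 2`, which `chainPoly` kills. The derivative passes
-- inward, each Hessian contributing a factor `X`, until it turns the gradient into one more Hessian
-- applied to `σ`.
open Polynomial in
theorem principal_derivAlong_term (σ : DerivTerm) : ∀ τ : DerivTerm,
    principal (DerivTerm.derivAlong σ τ) = X * σ.chainPoly * τ.chainPoly
  | .node 0 c => by
    simp [principal, DerivTerm.derivAlong, DerivTerm.chainPoly]
  | .node 1 c => by
    have ih := principal_derivAlong_term σ (c 0)
    have hc : principal ∘ₗ Finsupp.lmapDomain ℝ ℝ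
        (fun τ => DerivTerm.node 1 (Function.update c 0 τ)) =
        LinearMap.mulLeft ℝ (X : ℝ[X]) ∘ₗ principal := by
      refine Finsupp.lhom_ext' fun τ => LinearMap.ext_ring ?_
      simp [principal, DerivTerm.chainPoly]
    have hc' := LinearMap.congr_fun hc (DerivTerm.derivAlong σ (c 0))
    simp only [LinearMap.comp_apply, Finsupp.lmapDomain_apply, LinearMap.mulLeft_apply, ih] at hc'
    rw [DerivTerm.derivAlong, map_add, map_sum, Fin.sum_univ_one, hc', DerivTerm.chainPoly]
    simp only [principal, Finsupp.linearCombination_single, DerivTerm.chainPoly]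
    simp only [smul_zero, zero_add]
    ring
  | .node (m + 2) c => by
    have hc (i) : principal ∘ₗ Finsupp.lmapDomain ℝ ℝ
        (fun τ => DerivTerm.node (m + 2) (Function.update c i τ)) = 0 := by
      refine Finsupp.lhom_ext' fun τ => LinearMap.ext_ring ?_
      simp [principal, DerivTerm.chainPoly]
    have hc' (i) := LinearMap.congr_fun (hc i) (DerivTerm.derivAlong σ (c i))
    simp only [LinearMap.comp_apply, Finsupp.lmapDomain_apply, LinearMap.zero_apply] at hc'
    rw [DerivTerm.derivAlong, map_add, map_sum, sum_congr rfl fun i _ => hc' i]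
    simp [principal, DerivTerm.chainPoly]

open Polynomial in
theorem principal_derivAlong (a b : DerivExpr) :
    principal (derivAlong a b) = X * principal a * principal b := by
  refine linearCombination_derivAlong (op := fun p q : ℝ[X] => X * p * q)
    principal_derivAlong_term (fun a b => ?_) a b
  simp only [Finsupp.linearCombination_apply, Finsupp.sum, mul_sum, sum_mul]
  refine sum_congr rfl fun τ _ => sum_congr rfl fun σ _ => ?_
  simp only [smul_eq_C_mul, map_mul]
  ring

theorem coeff_principal (e : DerivExpr) (k : ℕ) :
    (principal e).coeff k = e (DerivTerm.chain k) := by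
  classical
  have h : Polynomial.lcoeff ℝ k ∘ₗ principal = Finsupp.lapply (DerivTerm.chain k) := by
    refine Finsupp.lhom_ext' fun τ => LinearMap.ext_ring ?_
    simp only [principal, LinearMap.comp_apply, Finsupp.lsingle_apply, Finsupp.lapply_apply,
      Finsupp.linearCombination_single, one_smul, Polynomial.lcoeff_apply]
    by_cases hτ : τ.HasHigherDeriv
    · rw [DerivTerm.chainPoly_eq_zero hτ, Polynomial.coeff_zero, Finsupp.single_apply, if_neg]
      rintro rfl
      exact DerivTerm.not_hasHigherDeriv_chain k hτ
    · obtain ⟨l, rfl⟩ := DerivTerm.exists_eq_chain hτ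
      rw [DerivTerm.chainPoly_chain, Polynomial.coeff_X_pow, Finsupp.single_apply]
      simp only [DerivTerm.chain_injective.eq_iff, eq_comm]
  exact LinearMap.congr_fun h e

/-- The coefficient of `h ^ p` in the modified vector field of gradient descent. -/
def modified (p : ℕ) : DerivExpr :=
  modSeq derivAlong (-Finsupp.single (DerivTerm.chain 0) 1) p

open Classical in
/-- The non-principal part of `DerivExpr.modified`. -/
def correction (p : ℕ) : DerivExpr :=
  (modified p).filter DerivTerm.HasHigherDeriv

theorem isNonPrincipal_correction (p : ℕ) : (correction p).IsNonPrincipal := fun τ hτ => by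
  classical
  rw [correction, Finsupp.support_filter, mem_filter] at hτ
  exact hτ.2

theorem principal_modified (p : ℕ) :
    principal (modified p) = Polynomial.C (-1 / ((p : ℝ) + 1)) * Polynomial.X ^ p := by
  rw [modified, map_modSeq (op' := fun p q => Polynomial.X * p * q) principal principal_derivAlong, ← modSeq_polynomial]
  congr 1
  simp [principal, DerivTerm.chainPoly_chain]

theorem modified_eq (p : ℕ) :
    modified p = Finsupp.single (DerivTerm.chain p) (-1 / ((p : ℝ) + 1)) + correction p := by
  classical
  ext τ
  rw [Finsupp.add_apply, correction, Finsupp.filter_apply]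
  split_ifs with hτ
  · rw [Finsupp.single_apply, if_neg, zero_add]
    rintro rfl
    exact DerivTerm.not_hasHigherDeriv_chain p hτ
  · obtain ⟨k, rfl⟩ := DerivTerm.exists_eq_chain hτ
    rw [← coeff_principal, principal_modified, Polynomial.coeff_C_mul_X_pow, add_zero,
      Finsupp.single_apply]
    simp only [DerivTerm.chain_injective.eq_iff, eq_comm]

end DerivExpr

/-! ### Evaluation of formal expressions as vector fields -/

/-- The derivative of the field `b` along the field `a`. -/
def lieDeriv {V : Type*} [NormedAddCommGroup V] [NormedSpace ℝ V] (a b : V → V) : V → V :=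
  fun θ => fderiv ℝ b θ (a θ)

theorem ContDiff.lieDeriv {V : Type*} [NormedAddCommGroup V] [NormedSpace ℝ V] {a b : V → V}
    (ha : ContDiff ℝ ∞ a) (hb : ContDiff ℝ ∞ b) : ContDiff ℝ ∞ (lieDeriv a b) :=
  (hb.fderiv_right (by simp)).clm_apply ha

/-- Evaluation `(A, v) ↦ A v` is the restriction to the diagonal of a continuous multilinear map
with slots `Option ι`, each slot receiving the whole pair. -/
theorem ContDiff.continuousMultilinearMap_apply {ι G F : Type*} [Fintype ι] {M : ι → Type*}
    [NormedAddCommGroup G] [NormedSpace ℝ G] [NormedAddCommGroup F] [NormedSpace ℝ F]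
    [∀ i, NormedAddCommGroup (M i)] [∀ i, NormedSpace ℝ (M i)] {n : WithTop ℕ∞}
    {f : G → ContinuousMultilinearMap ℝ M F} {g : ∀ i, G → M i}
    (hf : ContDiff ℝ n f) (hg : ∀ i, ContDiff ℝ n (g i)) :
    ContDiff ℝ n fun x => f x fun i => g i x := by
  have h := ((ContinuousLinearMap.id ℝ (ContinuousMultilinearMap ℝ M F)
    ).continuousMultilinearMapOption.contDiff (n := n)).comp
      (contDiff_pi.2 fun _ : Option ι => hf.prodMk (contDiff_pi.2 hg))
  exact h

section Eval

variable {D : ℕ} {E : Param D → ℝ}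

theorem ContDiff.gradient (hE : ContDiff ℝ ∞ E) : ContDiff ℝ ∞ (gradient E) :=
  (InnerProductSpace.toDual ℝ (Param D)).symm.contDiff.comp (hE.fderiv_right (by simp))

theorem DerivTerm.contDiff_eval (hE : ContDiff ℝ ∞ E) : ∀ τ : DerivTerm,
    ContDiff ℝ ∞ (τ.eval E)
  | .node m c => by
    refine ContDiff.continuousMultilinearMap_apply
      (ContDiff.iteratedFDeriv_right (n := ∞) (m := ∞) hE.gradient (by norm_cast)) fun i => ?_
    exact (c i).contDiff_eval hE

/-- Evaluation of formal expressions as a linear map. -/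
def DerivExpr.evalₗ (E : Param D → ℝ) : DerivExpr →ₗ[ℝ] (Param D → Param D) :=
  Finsupp.linearCombination ℝ fun τ => τ.eval E

theorem DerivExpr.evalₗ_apply (e : DerivExpr) (θ : Param D) :
    evalₗ E e θ = e.eval E θ := by
  simp [evalₗ, Finsupp.linearCombination_apply, eval, Finsupp.sum]

theorem DerivExpr.contDiff_evalₗ (hE : ContDiff ℝ ∞ E) (e : DerivExpr) :
    ContDiff ℝ ∞ (evalₗ E e) := by
  rw [evalₗ, Finsupp.linearCombination_apply, Finsupp.sum]
  have : (∑ a ∈ e.support, e a • DerivTerm.eval E a) =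
      fun θ => ∑ a ∈ e.support, e a • DerivTerm.eval E a θ := by
    ext1 θ; simp
  rw [this]
  exact ContDiff.sum fun τ _ => (τ.contDiff_eval hE).const_smul _

/-- This is the product rule: the derivative of the tensor adds a first slot filled with `σ`, and
each argument is differentiated in its own slot. -/
theorem DerivExpr.evalₗ_derivAlong_term (hE : ContDiff ℝ ∞ E) (σ : DerivTerm) : ∀ τ : DerivTerm,
    evalₗ E (σ.derivAlong τ) = lieDeriv (σ.eval E) (τ.eval E)
  | .node m c => by
    have hc (i) : evalₗ E (Finsupp.mapDomain
        (fun τ => DerivTerm.node m (Function.update c i τ)) (σ.derivAlong (c i))) =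
        fun θ => iteratedFDeriv ℝ m (gradient E) θ (Function.update (fun j => (c j).eval E θ) i
          (evalₗ E (σ.derivAlong (c i)) θ)) := by
      ext1 θ
      -- Both sides are linear in the expression inserted in slot `i`, so single terms suffice.
      have : LinearMap.proj θ ∘ₗ evalₗ E ∘ₗ Finsupp.lmapDomain ℝ ℝ
          (fun τ => DerivTerm.node m (Function.update c i τ)) =
          (iteratedFDeriv ℝ m (gradient E) θ).toMultilinearMap.toLinearMap
            (fun j => (c j).eval E θ) i ∘ₗ LinearMap.proj θ ∘ₗ evalₗ E := by
        refine Finsupp.lhom_ext' fun τ => LinearMap.ext_ring ?_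
        simp only [evalₗ, LinearMap.comp_apply, Finsupp.lsingle_apply, Finsupp.lmapDomain_apply,
          Finsupp.mapDomain_single, Finsupp.linearCombination_single, one_smul,
          LinearMap.proj_apply, MultilinearMap.toLinearMap_apply, DerivTerm.eval]
        refine congrArg (iteratedFDeriv ℝ m (gradient E) θ) (funext fun j => ?_)
        rcases eq_or_ne j i with rfl | hj <;> simp [*]
      exact LinearMap.congr_fun this (σ.derivAlong (c i))
    ext1 θ
    have hd : ∀ i, HasFDerivAt ((c i).eval E) (fderiv ℝ ((c i).eval E) θ) θ := fun i =>
      (((c i).contDiff_eval hE).differentiable (by simp) θ).hasFDerivAt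
    have hI : HasFDerivAt (iteratedFDeriv ℝ m (gradient E))
        (fderiv ℝ (iteratedFDeriv ℝ m (gradient E)) θ) θ :=
      ((ContDiff.iteratedFDeriv_right (n := ∞) (m := ∞) hE.gradient (by norm_cast)).differentiable
        (by simp) θ).hasFDerivAt
    have hmain := (hI.continuousMultilinearMap_apply hd).fderiv
    have heval : DerivTerm.eval E (.node m c) =
        fun x => iteratedFDeriv ℝ m (gradient E) x fun i => (c i).eval E x := rfl
    rw [lieDeriv, heval, hmain, DerivTerm.derivAlong, map_add, map_sum,
      sum_congr rfl fun i _ => hc i]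
    simp only [Pi.add_apply, Finset.sum_apply, add_apply,
      _root_.sum_apply, ContinuousLinearMap.comp_apply]
    congr 1
    · simp only [evalₗ, Finsupp.linearCombination_single, one_smul, DerivTerm.eval]
      rw [iteratedFDeriv_succ_apply_left]
      rfl
    · refine sum_congr rfl fun i _ => ?_
      rw [evalₗ_derivAlong_term hE σ (c i)]
      rfl

/-- The operation `lieDeriv` is additive in its second argument only for differentiable fields;
smoothness of `E` supplies this for evaluated terms. -/
theorem DerivExpr.evalₗ_derivAlong (hE : ContDiff ℝ ∞ E) (a b : DerivExpr) :
    evalₗ E (a.derivAlong b) = lieDeriv (evalₗ E a) (evalₗ E b) := by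
  refine linearCombination_derivAlong (op := lieDeriv) (evalₗ_derivAlong_term hE)
    (fun a b => ?_) a b
  have hb : Finsupp.linearCombination ℝ (fun τ => DerivTerm.eval E τ) b =
      fun θ => ∑ τ ∈ b.support, b τ • DerivTerm.eval E τ θ := by
    ext1 θ; simp [Finsupp.linearCombination_apply, Finsupp.sum]
  ext1 θ
  rw [lieDeriv, hb, fderiv_fun_sum fun τ _ =>
    (((τ.contDiff_eval hE).differentiable (by simp)).const_smul (b τ)) θ]
  simp only [Finsupp.linearCombination_apply, Finsupp.sum, Finset.sum_apply,
    _root_.sum_apply, Pi.smul_apply, lieDeriv]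
  refine sum_congr rfl fun τ _ => ?_
  rw [fderiv_fun_const_smul ((τ.contDiff_eval hE).differentiable (by simp) θ)]
  rw [map_sum]
  refine sum_congr rfl fun σ _ => ?_
  simp only [map_smul, smul_apply, smul_smul]

theorem DerivTerm.eval_chain (k : ℕ) (θ : Param D) :
    (chain k).eval E θ = (hessian E θ ^ k) (gradient E θ) := by
  induction k with
  | zero => simp [chain, eval]
  | succ k ih =>
    rw [chain, pow_succ']
    simp only [eval, iteratedFDeriv_one_apply, ih]
    rfl

theorem DerivExpr.evalₗ_modified (hE : ContDiff ℝ ∞ E) (p : ℕ) :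
    evalₗ E (modified p) = modSeq lieDeriv (fun θ => -gradient E θ) p := by
  rw [modified, map_modSeq _ (evalₗ_derivAlong hE)]
  congr 1
  ext1 θ
  simp [evalₗ, DerivTerm.eval_chain]

theorem DerivExpr.evalₗ_modified_apply (p : ℕ) (θ : Param D) :
    evalₗ E (modified p) θ = (-1 / ((p : ℝ) + 1)) • (hessian E θ ^ p) (gradient E θ) +
      (correction p).eval E θ := by
  rw [modified_eq, map_add, Pi.add_apply, evalₗ_apply (correction p)]
  simp [evalₗ, DerivTerm.eval_chain]

end Eval

/-! ### Expansion of the flow in powers of the step size -/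

theorem sum_range_mul_range_eq_sum_antidiagonal {M : Type*} [AddCommMonoid M] {A B : ℕ}
    {g : ℕ → ℕ → M} (hA : ∀ i l, A < i → g i l = 0) (hB : ∀ i l, B < l → g i l = 0) :
    ∑ i ∈ range (A + 1), ∑ l ∈ range (B + 1), g i l =
      ∑ j ∈ range (A + B + 1), ∑ p ∈ antidiagonal j, g p.1 p.2 := by
  rw [← sum_product', Finset.sum_sigma']
  refine sum_bij_ne_zero (fun p _ _ => ⟨p.1 + p.2, p⟩) ?_ ?_ ?_ ?_
  · intro p hp _
    simp only [mem_product, mem_range] at hp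
    simp only [mem_sigma, mem_range, HasAntidiagonal.mem_antidiagonal, and_true]
    omega
  · rintro ⟨a, b⟩ _ _ ⟨a', b'⟩ _ _ h
    simpa using (Sigma.mk.inj_iff.1 h).2
  · rintro ⟨j, p⟩ hj hg
    simp only [mem_sigma, HasAntidiagonal.mem_antidiagonal] at hj
    refine ⟨p, ?_, hg, by rw [hj.2]⟩
    simp only [mem_product, mem_range]
    refine ⟨?_, ?_⟩ <;> by_contra hlt
    · exact hg (hA p.1 p.2 (by omega))
    · exact hg (hB p.1 p.2 (by omega))
  · intro p _ _; rfl

section Fields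

variable {V : Type*} [NormedAddCommGroup V] [NormedSpace ℝ V]

/-- The norm estimate in Taylor's theorem for a function given with its successive derivatives. -/
theorem norm_sub_taylor_le {T M : ℝ} (n : ℕ) {u : ℕ → ℝ → V}
    (hu : ∀ k < n, ∀ t ∈ Set.Icc 0 T, HasDerivWithinAt (u k) (u (k + 1) t) (Set.Icc 0 T) t)
    (hM : ∀ t ∈ Set.Icc 0 T, ‖u n t‖ ≤ M) :
    ∀ t ∈ Set.Icc 0 T, ‖u 0 t - ∑ k ∈ range n, (t ^ k / (k.factorial : ℝ)) • u k 0‖ ≤ M * T ^ n := by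
  induction n generalizing u with
  | zero => intro t ht; simpa using hM t ht
  | succ n ih =>
    intro t ht
    have h1 := ih (u := fun k => u (k + 1)) (fun k hk => hu (k + 1) (by omega)) hM
    have hT : 0 ≤ T := ht.1.trans ht.2
    have hC : 0 ≤ M * T ^ n := (norm_nonneg _).trans (h1 t ht)
    set R : ℝ → V := fun t => u 0 t - ∑ k ∈ range (n + 1), (t ^ k / (k.factorial : ℝ)) • u k 0
    have hR : ∀ s ∈ Set.Icc 0 T, HasDerivWithinAt R
        (u 1 s - ∑ k ∈ range n, (s ^ k / (k.factorial : ℝ)) • u (k + 1) 0) (Set.Icc 0 T) s := by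
      intro s hs
      refine (hu 0 (by omega) s hs).sub ?_
      have hsum : ∀ k ∈ range (n + 1), HasDerivWithinAt
          (fun t : ℝ => (t ^ k / (k.factorial : ℝ)) • u k 0)
          ((k * s ^ (k - 1) / (k.factorial : ℝ)) • u k 0) (Set.Icc 0 T) s := fun k _ =>
        (((hasDerivAt_pow k s).div_const _).smul_const _).hasDerivWithinAt
      convert HasDerivWithinAt.fun_sum hsum using 1
      rw [sum_range_succ']
      simp only [Nat.cast_zero, zero_mul, zero_div, zero_smul, add_zero]
      refine sum_congr rfl fun k _ => ?_
      congr 1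
      have : (k.factorial : ℝ) ≠ 0 := by positivity
      have : (k : ℝ) + 1 ≠ 0 := by positivity
      rw [Nat.factorial_succ, Nat.add_sub_cancel]
      push_cast
      field_simp
    -- The derivative of the remainder is the remainder of `u 1`, so the mean value inequality costs
    -- one factor `T`.
    have h2 := norm_image_sub_le_of_norm_deriv_le_segment' hR
      (fun s hs => h1 s (Set.Ico_subset_Icc_self hs)) t ht
    have hR0 : R 0 = 0 := by
      simp only [R]
      rw [sum_range_succ']
      simp
    rw [hR0, sub_zero, sub_zero] at h2
    refine h2.trans ?_
    rw [pow_succ, ← mul_assoc]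
    exact mul_le_mul_of_nonneg_left ht.2 hC

/-- The derivatives of a solution of `θ' = a θ`, as functions of its position. -/
def flowDeriv (a : V → V) : ℕ → V → V
  | 0 => a
  | k + 1 => lieDeriv a (flowDeriv a k)

theorem ContDiff.flowDeriv {a : V → V} (ha : ContDiff ℝ ∞ a) (k : ℕ) :
    ContDiff ℝ ∞ (flowDeriv a k) := by
  induction k with
  | zero => exact ha
  | succ k ih => exact ha.lieDeriv ih

variable {f : ℕ → V → V}

theorem contDiff_iterDeriv (hf : ∀ p, ContDiff ℝ ∞ (f p)) (k : ℕ) :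
    ∀ j, ContDiff ℝ ∞ (iterDeriv lieDeriv f k j) := by
  induction k with
  | zero => exact hf
  | succ k ih =>
    intro j
    have : iterDeriv lieDeriv f (k + 1) j =
        fun θ => ∑ p ∈ antidiagonal j, lieDeriv (f p.2) (iterDeriv lieDeriv f k p.1) θ := by
      ext1 θ; simp [iterDeriv]
    rw [this]
    exact ContDiff.sum fun p _ => (hf p.2).lieDeriv (ih p.1)

theorem lieDeriv_zero_left (b : V → V) : lieDeriv 0 b = 0 := by
  ext1 θ; simp [lieDeriv]

theorem lieDeriv_zero_right (a : V → V) : lieDeriv a 0 = 0 := by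
  ext1 θ; simp [lieDeriv]

theorem iterDeriv_eq_zero {n : ℕ} (h0 : ∀ p, n < p → f p = 0) (k : ℕ) :
    ∀ j, (k + 1) * n < j → iterDeriv lieDeriv f k j = 0 := by
  induction k with
  | zero => intro j hj; exact h0 j (by simpa using hj)
  | succ k ih =>
    intro j hj
    refine sum_eq_zero fun p hp => ?_
    have hp' := HasAntidiagonal.mem_antidiagonal.1 hp
    rcases lt_or_ge n p.2 with h | h
    · rw [h0 _ h, lieDeriv_zero_left]
    · have : (k + 1) * n < p.1 := by
        have : (k + 1 + 1) * n = (k + 1) * n + n := by ring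
        omega
      rw [ih _ this, lieDeriv_zero_right]

/-- Each further derivative multiplies by a polynomial of degree `n` in `h`; grouping by powers of
`h` reproduces the recursion of `iterDeriv`. -/
theorem flowDeriv_eq_sum {n : ℕ} (hf : ∀ p, ContDiff ℝ ∞ (f p)) (h0 : ∀ p, n < p → f p = 0)
    (h : ℝ) (k : ℕ) : flowDeriv (fun θ => ∑ p ∈ range (n + 1), h ^ p • f p θ) k =
      fun θ => ∑ j ∈ range ((k + 1) * n + 1), h ^ j • iterDeriv lieDeriv f k j θ := by
  induction k with
  | zero => simp [flowDeriv, iterDeriv]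
  | succ k ih =>
    ext1 θ
    have hd (j : ℕ) : DifferentiableAt ℝ (iterDeriv lieDeriv f k j) θ :=
      (contDiff_iterDeriv hf k j).differentiable (by simp) θ
    rw [flowDeriv, ih, lieDeriv, fderiv_fun_sum fun j _ => (hd j).fun_const_smul _,
      show (k + 1 + 1) * n = (k + 1) * n + n by ring]
    have hr : ∀ j, h ^ j • iterDeriv lieDeriv f (k + 1) j θ =
        ∑ p ∈ antidiagonal j,
          h ^ (p.1 + p.2) • fderiv ℝ (iterDeriv lieDeriv f k p.1) θ (f p.2 θ) := by
      intro j
      rw [iterDeriv, Finset.sum_apply, smul_sum]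
      refine sum_congr rfl fun p hp => ?_
      rw [HasAntidiagonal.mem_antidiagonal.1 hp, lieDeriv]
    simp only [hr]
    rw [← sum_range_mul_range_eq_sum_antidiagonal
      (g := fun i l => h ^ (i + l) • fderiv ℝ (iterDeriv lieDeriv f k i) θ (f l θ))]
    · rw [_root_.sum_apply]
      refine sum_congr rfl fun i _ => ?_
      rw [fderiv_fun_const_smul (hd i), map_sum]
      refine sum_congr rfl fun l _ => ?_
      simp only [map_smul, smul_apply, smul_smul, pow_add, mul_comm]
    · intro i l hi
      rw [iterDeriv_eq_zero h0 k i hi]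
      simp
    · intro i l hl
      rw [h0 l hl]
      simp

/-- Expansion in `h` of the Taylor polynomial of the flow of `∑ hᵖ f p`. -/
theorem exists_norm_taylor_sub_le {n : ℕ} (hf : ∀ p, ContDiff ℝ ∞ (f p))
    (h0 : ∀ p, n < p → f p = 0) (θ : V) :
    ∃ K : ℝ, ∀ h ∈ Set.Icc (0 : ℝ) 1,
      ‖∑ k ∈ range (n + 1), (h ^ (k + 1) / ((k + 1).factorial : ℝ)) •
          flowDeriv (fun θ => ∑ p ∈ range (n + 1), h ^ p • f p θ) k θ -
        ∑ q ∈ range (n + 1), h ^ (q + 1) • stepCoeff lieDeriv f q θ‖ ≤ K * h ^ (n + 2) := by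
  refine ⟨∑ k ∈ range (n + 1), ∑ x ∈ range ((k + 1) * n + 1),
    ‖iterDeriv lieDeriv f k (n + 1 - k + x) θ‖, fun h hh => ?_⟩
  have hsplit : ∀ k ∈ range (n + 1), (h ^ (k + 1) / ((k + 1).factorial : ℝ)) •
      flowDeriv (fun θ => ∑ p ∈ range (n + 1), h ^ p • f p θ) k θ =
      ∑ j ∈ range (n + 1 - k), (h ^ (k + j + 1) / ((k + 1).factorial : ℝ)) •
        iterDeriv lieDeriv f k j θ +
      ∑ x ∈ range ((k + 1) * n + 1), (h ^ (n + 2 + x) / ((k + 1).factorial : ℝ)) •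
        iterDeriv lieDeriv f k (n + 1 - k + x) θ := by
    intro k hk
    have hk' := mem_range.1 hk
    rw [flowDeriv_eq_sum hf h0]
    -- Padding with zeros allows a cut at `j = n + 1 - k`, where `h^(k+1+j)` reaches `h^(n+2)`.
    have : ∑ j ∈ range ((k + 1) * n + 1), h ^ j • iterDeriv lieDeriv f k j θ =
        ∑ j ∈ range (n + 1 - k + ((k + 1) * n + 1)), h ^ j • iterDeriv lieDeriv f k j θ := by
      refine sum_subset (range_mono (by omega)) fun j _ hj => ?_
      rw [iterDeriv_eq_zero h0 k j (by simpa using hj), Pi.zero_apply, smul_zero]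
    simp only [this]
    rw [sum_range_add, smul_add, smul_sum, smul_sum]
    congr 1
    · refine sum_congr rfl fun j _ => ?_
      rw [smul_smul]
      congr 1
      ring
    · refine sum_congr rfl fun x _ => ?_
      rw [smul_smul]
      congr 1
      rw [show n + 2 + x = k + 1 + (n + 1 - k + x) by omega, pow_add h (k + 1)]
      ring
  have hdiag : ∑ q ∈ range (n + 1), h ^ (q + 1) • stepCoeff lieDeriv f q θ =
      ∑ k ∈ range (n + 1), ∑ j ∈ range (n + 1 - k), (h ^ (k + j + 1) / ((k + 1).factorial : ℝ)) •
        iterDeriv lieDeriv f k j θ := by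
    rw [← sum_range_diag_flip (n + 1)
      fun k j => (h ^ (k + j + 1) / ((k + 1).factorial : ℝ)) • iterDeriv lieDeriv f k j θ]
    refine sum_congr rfl fun q _ => ?_
    rw [stepCoeff, Finset.sum_apply, smul_sum]
    refine sum_congr rfl fun k hk => ?_
    have hk' := mem_range.1 hk
    rw [Pi.smul_apply, smul_smul, show k + (q - k) = q by omega]
    congr 1
    ring
  rw [sum_congr rfl hsplit, sum_add_distrib, hdiag, add_sub_cancel_left, sum_mul]
  refine (norm_sum_le _ _).trans (sum_le_sum fun k _ => ?_)
  rw [sum_mul]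
  refine (norm_sum_le _ _).trans (sum_le_sum fun x _ => ?_)
  rw [norm_smul, mul_comm]
  refine mul_le_mul_of_nonneg_left ?_ (norm_nonneg _)
  have hh0 := hh.1
  rw [Real.norm_of_nonneg (by positivity)]
  calc h ^ (n + 2 + x) / ((k + 1).factorial : ℝ) ≤ h ^ (n + 2 + x) / 1 := by
        gcongr
        exact_mod_cast Nat.factorial_pos _
    _ ≤ h ^ (n + 2) := by
        rw [div_one]
        exact pow_le_pow_of_le_one hh.1 hh.2 (by omega)

/-- Compactness of `[0, 1]` times the ball makes the bound independent of `h`. -/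
theorem exists_norm_sum_smul_le [ProperSpace V] (N : ℕ) {g : ℕ → V → V}
    (hg : ∀ j, Continuous (g j)) (θ₀ : V) :
    ∃ M : ℝ, 0 ≤ M ∧ ∀ h ∈ Set.Icc (0 : ℝ) 1, ∀ θ ∈ Metric.closedBall θ₀ 1,
      ‖∑ j ∈ range N, h ^ j • g j θ‖ ≤ M := by
  have hc : Continuous fun x : ℝ × V => ∑ j ∈ range N, x.1 ^ j • g j x.2 :=
    continuous_finsetSum _ fun j _ =>
      (continuous_fst.pow j).smul ((hg j).comp continuous_snd)
  obtain ⟨M, hM⟩ := (isCompact_Icc.prod (isCompact_closedBall θ₀ 1)).exists_bound_of_continuousOn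
    (s := Set.Icc (0 : ℝ) 1 ×ˢ Metric.closedBall θ₀ 1) hc.continuousOn
  exact ⟨max M 0, le_max_right _ _, fun h hh θ hθ =>
    (hM (h, θ) ⟨hh, hθ⟩).trans (le_max_left _ _)⟩

/-- A family of vectors vanishes if the polynomial with these coefficients is of the order of the
first omitted power. -/
theorem eq_zero_of_norm_sum_smul_le (m : ℕ) {b : ℕ → V} {K h₀ : ℝ} (hh₀ : 0 < h₀)
    (hb : ∀ h, 0 < h → h < h₀ → ‖∑ q ∈ range m, h ^ q • b q‖ ≤ K * h ^ m) :
    ∀ q < m, b q = 0 := by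
  induction m generalizing b with
  | zero => intro q hq; omega
  | succ m ih =>
    have hb0 : b 0 = 0 := by
      have h1 : Filter.Tendsto (fun h : ℝ => ‖∑ q ∈ range (m + 1), h ^ q • b q‖)
          (nhdsWithin 0 (Set.Ioi 0)) (nhds ‖b 0‖) := by
        have : Continuous fun h : ℝ => ‖∑ q ∈ range (m + 1), h ^ q • b q‖ :=
          (continuous_finsetSum _ fun j _ => (continuous_pow j).smul continuous_const).norm
        refine (this.tendsto' 0 _ ?_).mono_left nhdsWithin_le_nhds
        rw [sum_range_succ']
        simp
      have h2 : Filter.Tendsto (fun h : ℝ => K * h ^ (m + 1))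
          (nhdsWithin 0 (Set.Ioi 0)) (nhds 0) := by
        have : Continuous fun h : ℝ => K * h ^ (m + 1) := by fun_prop
        exact (this.tendsto' 0 _ (by simp)).mono_left nhdsWithin_le_nhds
      have h3 := le_of_tendsto_of_tendsto h1 h2
        (Filter.eventually_of_mem (Ioo_mem_nhdsGT hh₀) fun h hh => hb h hh.1 hh.2)
      exact norm_le_zero_iff.1 h3
    -- Once `b 0 = 0`, a factor `h` can be cancelled.
    have hs := ih (b := fun q => b (q + 1)) fun h hpos hlt => by
      have h1 := hb h hpos hlt
      rw [sum_range_succ', hb0, smul_zero, add_zero] at h1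
      have h2 : ∑ q ∈ range m, h ^ (q + 1) • b (q + 1) =
          h • ∑ q ∈ range m, h ^ q • b (q + 1) := by
        rw [smul_sum]
        exact sum_congr rfl fun q _ => by rw [smul_smul, pow_succ']
      rw [h2, norm_smul, Real.norm_of_nonneg hpos.le, pow_succ', mul_left_comm] at h1
      exact le_of_mul_le_mul_left h1 hpos
    intro q hq
    rcases q with _ | q
    · exact hb0
    · exact hs q (by omega)

end Fields

/-! ### Existence, confinement and expansion of solutions -/

section Flow

variable {D : ℕ} {f : ℕ → Param D → Param D}

/-- A solution does not leave the unit ball as long as the field there is too slow for it. -/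
theorem IsSolution.mem_closedBall {F : Param D → Param D} {θ₀ : Param D} {T M : ℝ}
    {γ : ℝ → Param D} (hγ : IsSolution F θ₀ T γ) (hM0 : 0 ≤ M)
    (hM : ∀ θ ∈ Metric.closedBall θ₀ 1, ‖F θ‖ ≤ M) (hT : (M + 1) * T ≤ 1) :
    ∀ t ∈ Set.Icc 0 T, γ t ∈ Metric.closedBall θ₀ 1 := by
  have hlt : ∀ t ∈ Set.Icc 0 T, (M + 1) * t ≤ 1 := fun t ht =>
    (mul_le_mul_of_nonneg_left ht.2 (by linarith)).trans hT
  -- The barrier needs a slope strictly above the speed bound `M`, hence `M + 1`.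
  have hB : ∀ t : ℝ, HasDerivAt (fun t => (M + 1) * t) (M + 1) t := fun t => by
    simpa using (hasDerivAt_id t).const_mul (M + 1)
  have hd : ∀ t ∈ Set.Ico 0 T,
      HasDerivWithinAt (fun t => γ t - θ₀) (F (γ t)) (Set.Ici t) t := fun t ht =>
    ((hγ.2 t (Set.Ico_subset_Icc_self ht)).sub_const _).mono_of_mem_nhdsWithin
      (Icc_mem_nhdsGE_of_mem ht)
  have hc : ContinuousOn (fun t => γ t - θ₀) (Set.Icc 0 T) := fun t ht =>
    ((hγ.2 t ht).sub_const _).continuousWithinAt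
  intro t ht
  rw [mem_closedBall_iff_norm]
  refine (image_norm_le_of_norm_deriv_right_lt_deriv_boundary hc hd ?_ hB ?_ ht).trans (hlt t ht)
  · simp [hγ.1]
  · intro s hs hs'
    have : γ s ∈ Metric.closedBall θ₀ 1 := by
      rw [mem_closedBall_iff_norm, hs']
      exact hlt s (Set.Ico_subset_Icc_self hs)
    linarith [hM _ this]

theorem IsSolution.norm_sub_taylor_le {a : Param D → Param D} (ha : ContDiff ℝ ∞ a)
    {θ₀ : Param D} {h M : ℝ} (hh : 0 ≤ h) {γ : ℝ → Param D} (hγ : IsSolution a θ₀ h γ) (n : ℕ)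
    (hM : ∀ t ∈ Set.Icc 0 h, ‖flowDeriv a n (γ t)‖ ≤ M) :
    ‖γ h - (θ₀ + ∑ k ∈ range n, (h ^ (k + 1) / ((k + 1).factorial : ℝ)) • flowDeriv a k θ₀)‖ ≤
      M * h ^ (n + 1) := by
  have h1 := _root_.norm_sub_taylor_le (T := h) (M := M) (n + 1)
    -- The zeroth derivative is `γ` itself, so `flowDeriv a k` is derivative number `k + 1`.
    (u := fun k => Nat.rec γ (fun k _ t => flowDeriv a k (γ t)) k) ?_ hM h ⟨hh, le_rfl⟩
  · rw [sum_range_succ', add_comm] at h1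
    simpa [hγ.1] using h1
  · intro k _ t ht
    rcases k with _ | k
    · exact hγ.2 t ht
    · exact ((ha.flowDeriv k).differentiable (by simp) (γ t)).hasFDerivAt.comp_hasDerivWithinAt t
        (hγ.2 t ht)

/-- Taking `h` as a state variable with zero velocity, Picard–Lindelöf near `(θ₀, 0)` gives an
existence time `ε` common to all small `h`; then `h < ε` suffices. -/
theorem exists_isSolution (hf : ∀ p, ContDiff ℝ ∞ (f p)) (N : ℕ) (θ₀ : Param D) :
    ∃ h₀ > 0, ∀ h : ℝ, 0 < h → h < h₀ →
      ∃ γ, IsSolution (fun θ => ∑ p ∈ range N, h ^ p • f p θ) θ₀ h γ := by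
  have hG : ContDiff ℝ 1 fun x : Param D × ℝ =>
      ((∑ p ∈ range N, x.2 ^ p • f p x.1, 0) : Param D × ℝ) := by
    refine ContDiff.prodMk (ContDiff.sum fun p _ => ?_) contDiff_const
    exact (contDiff_snd.pow p).smul (((hf p).of_le (by norm_cast)).comp contDiff_fst)
  obtain ⟨r, hr, ε, hε, H⟩ := (hG.contDiffAt
    (x := (θ₀, 0))).exists_forall_mem_closedBall_exists_eq_forall_mem_Ioo_hasDerivAt 0
  refine ⟨min r ε, lt_min hr hε, fun h hpos hlt => ?_⟩
  obtain ⟨α, hα0, hα⟩ := H (θ₀, h) (by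
    rw [Metric.mem_closedBall, Prod.dist_eq]
    simp only [dist_self, Real.dist_eq, sub_zero, abs_of_pos hpos]
    exact max_le hr.le (hlt.le.trans (min_le_left _ _)))
  have hmem : ∀ t ∈ Set.Icc 0 h, t ∈ Set.Ioo (0 - ε) (0 + ε) := fun t ht =>
    ⟨by linarith [ht.1], by linarith [ht.2, hlt.trans_le (min_le_right r ε)]⟩
  have h2 : ∀ t ∈ Set.Icc 0 h, (α t).2 = h := by
    intro t ht
    have := norm_image_sub_le_of_norm_deriv_le_segment' (f := fun t => (α t).2) (f' := fun _ => 0)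
      (C := 0) (fun s hs => (hα s (hmem s hs)).hasDerivWithinAt.snd) (by simp) t ht
    rw [zero_mul, norm_le_zero_iff, sub_eq_zero, hα0] at this
    exact this
  refine ⟨fun t => (α t).1, congrArg Prod.fst hα0, fun t ht => ?_⟩
  have h3 := (hα t (hmem t ht)).hasDerivWithinAt (s := Set.Icc 0 h) |>.fst
  rw [h2 t ht] at h3
  exact h3

theorem exists_norm_flow_sub_le {n : ℕ} (hf : ∀ p, ContDiff ℝ ∞ (f p))
    (h0 : ∀ p, n < p → f p = 0) (θ₀ : Param D) :
    ∃ K : ℝ, ∃ h₀ > 0, ∀ h : ℝ, 0 < h → h < h₀ →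
      (∃ γ, IsSolution (fun θ => ∑ p ∈ range (n + 1), h ^ p • f p θ) θ₀ h γ) ∧
      ∀ γ, IsSolution (fun θ => ∑ p ∈ range (n + 1), h ^ p • f p θ) θ₀ h γ →
        ‖γ h - (θ₀ + ∑ q ∈ range (n + 1), h ^ (q + 1) • stepCoeff lieDeriv f q θ₀)‖ ≤
          K * h ^ (n + 2) := by
  obtain ⟨h₁, hh₁, hex⟩ := exists_isSolution hf (n + 1) θ₀
  obtain ⟨M, hM0, hM⟩ := exists_norm_sum_smul_le (n + 1) (fun p => (hf p).continuous) θ₀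
  obtain ⟨L, -, hL⟩ := exists_norm_sum_smul_le ((n + 1 + 1) * n + 1)
    (fun j => (contDiff_iterDeriv hf (n + 1) j).continuous) θ₀
  obtain ⟨K, hK⟩ := exists_norm_taylor_sub_le hf h0 θ₀
  -- `L` bounds the Taylor remainder and `K` the discarded powers of `h`; `h < 1 / (M + 1)` keeps
  -- the solution in the unit ball.
  refine ⟨L + K, min h₁ (1 / (M + 1)), lt_min hh₁ (by positivity), fun h hpos hlt =>
    ⟨hex h hpos (hlt.trans_le (min_le_left _ _)), fun γ hγ => ?_⟩⟩
  have hM1 : (M + 1) * h ≤ 1 := by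
    have := (hlt.trans_le (min_le_right _ _)).le
    rwa [le_div_iff₀ (by positivity), mul_comm] at this
  have hh : h ∈ Set.Icc (0 : ℝ) 1 := ⟨hpos.le, by nlinarith⟩
  have hball := hγ.mem_closedBall hM0 (hM h hh) hM1
  have ha : ContDiff ℝ ∞ fun θ => ∑ p ∈ range (n + 1), h ^ p • f p θ :=
    ContDiff.sum fun p _ => (hf p).const_smul _
  have h1 := hγ.norm_sub_taylor_le ha hpos.le (n + 1) (M := L) fun t ht => by
    rw [flowDeriv_eq_sum hf h0]
    exact hL h hh _ (hball t ht)
  have h2 := hK h hh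
  rw [← add_sub_add_left_eq_sub _ _ θ₀] at h2
  rw [add_mul]
  exact (norm_sub_le_norm_sub_add_norm_sub _ _ _).trans (add_le_add h1 h2)

end Flow

/-! ### Order conditions and the modified field -/

section ModifiedField

variable {D n : ℕ} {E : Param D → ℝ}

/-- The coefficients of a truncated field, continued by zero. -/
def extendZero (f : Fin (n + 1) → Param D → Param D) (p : ℕ) : Param D → Param D :=
  if hp : p < n + 1 then f ⟨p, hp⟩ else 0

theorem truncatedField_eq (f : Fin (n + 1) → Param D → Param D) (h : ℝ) :
    truncatedField f h = fun θ => ∑ p ∈ range (n + 1), h ^ p • extendZero f p θ := by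
  ext1 θ
  rw [truncatedField, ← Fin.sum_univ_eq_sum_range fun p => h ^ p • extendZero f p θ]
  refine sum_congr rfl fun p _ => ?_
  rw [extendZero, dif_pos p.2]

theorem contDiff_extendZero {f : Fin (n + 1) → Param D → Param D}
    (hf : ∀ p, ContDiff ℝ ∞ (f p)) (p : ℕ) : ContDiff ℝ ∞ (extendZero f p) := by
  rw [extendZero]
  split_ifs with hp
  · exact hf _
  · exact contDiff_const

theorem extendZero_of_lt (f : Fin (n + 1) → Param D → Param D) (p : ℕ) (hp : n < p) :
    extendZero f p = 0 :=
  dif_neg (by omega)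

/-- The order conditions for modified vector fields. -/
theorem isModifiedField_iff {f : Fin (n + 1) → Param D → Param D} :
    IsModifiedField n E f ↔ (∀ p, ContDiff ℝ ∞ (f p)) ∧ ∀ q ≤ n,
      stepCoeff lieDeriv (extendZero f) q = if q = 0 then fun θ => -gradient E θ else 0 := by
  have hsum (h : ℝ) (θ₀ : Param D) : θ₀ - h • gradient E θ₀ = θ₀ + ∑ q ∈ range (n + 1),
      h ^ (q + 1) • (if q = 0 then fun θ => -gradient E θ else 0 : Param D → Param D) θ₀ := by
    rw [sum_range_succ']
    simp [sub_eq_add_neg]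
  constructor
  · intro hf
    refine ⟨hf.smooth, fun q hq => funext fun θ₀ => ?_⟩
    obtain ⟨K, h₀, hh₀, H⟩ := hf.error θ₀
    obtain ⟨K', h₀', hh₀', H'⟩ := exists_norm_flow_sub_le (contDiff_extendZero hf.smooth)
      (extendZero_of_lt f) θ₀
    -- Both expansions approximate the same `γ h`, so their difference is a polynomial in `h` of
    -- size `O(h^(n+2))`. One factor `h` is common to all its terms, which leaves `n + 1`
    -- coefficients and order `n + 1`.
    have hz := eq_zero_of_norm_sum_smul_le (n + 1) (h₀ := min h₀ h₀') (K := K + K')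
      (b := fun q => stepCoeff lieDeriv (extendZero f) q θ₀ -
        (if q = 0 then fun θ => -gradient E θ else 0 : Param D → Param D) θ₀) (lt_min hh₀ hh₀')
      fun h hpos hlt => ?_
    · exact sub_eq_zero.1 (hz q (by omega))
    obtain ⟨⟨γ, hγ⟩, h1⟩ := H h hpos (hlt.trans_le (min_le_left _ _))
    have h2 := h1 γ hγ
    have h3 := (H' h hpos (hlt.trans_le (min_le_right _ _))).2 γ (truncatedField_eq f h ▸ hγ)
    rw [hsum] at h2
    rw [norm_sub_rev] at h3
    have h4 := (norm_sub_le_norm_sub_add_norm_sub _ _ _).trans (add_le_add h3 h2)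
    rw [add_sub_add_left_eq_sub, ← sum_sub_distrib] at h4
    have h5 : ∑ q ∈ range (n + 1), (h ^ (q + 1) • stepCoeff lieDeriv (extendZero f) q θ₀ -
        h ^ (q + 1) • (if q = 0 then fun θ => -gradient E θ else 0 : Param D → Param D) θ₀) =
        h • ∑ q ∈ range (n + 1), h ^ q • (stepCoeff lieDeriv (extendZero f) q θ₀ -
          (if q = 0 then fun θ => -gradient E θ else 0 : Param D → Param D) θ₀) := by
      rw [smul_sum]
      exact sum_congr rfl fun q _ => by rw [← smul_sub, smul_smul, pow_succ']
    rw [h5, norm_smul, Real.norm_of_nonneg hpos.le] at h4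
    refine le_of_mul_le_mul_left (h4.trans_eq ?_) hpos
    ring
  · rintro ⟨hs, hq⟩
    refine ⟨hs, fun θ₀ => ?_⟩
    obtain ⟨K, h₀, hh₀, H⟩ := exists_norm_flow_sub_le (contDiff_extendZero hs)
      (extendZero_of_lt f) θ₀
    refine ⟨K, h₀, hh₀, fun h hpos hlt => ?_⟩
    rw [hsum, truncatedField_eq, ← sum_congr rfl fun q hq' =>
      congrArg (h ^ (q + 1) • ·) (congrFun (hq q (by simpa [Nat.lt_succ_iff] using hq')) θ₀)]
    exact H h hpos hlt

theorem isModifiedField_iff_eq (hE : ContDiff ℝ ∞ E) {f : Fin (n + 1) → Param D → Param D} :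
    IsModifiedField n E f ↔ ∀ p, f p = DerivExpr.evalₗ E (DerivExpr.modified p) := by
  have hext (p : Fin (n + 1)) : extendZero f p = f p := dif_pos p.2
  rw [isModifiedField_iff]
  constructor
  · rintro ⟨-, hq⟩ p
    rw [DerivExpr.evalₗ_modified hE, ← eq_modSeq _ _ hq p (by omega), hext]
  · intro hf
    refine ⟨fun p => hf p ▸ DerivExpr.contDiff_evalₗ hE _, fun q hq => ?_⟩
    rw [← stepCoeff_modSeq]
    -- Conditions up to order `n` see only coefficients up to `n`, so continuing by zero is
    -- harmless.
    refine stepCoeff_congr _ fun i hi => ?_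
    rw [← DerivExpr.evalₗ_modified hE]
    exact (hext ⟨i, by omega⟩).trans (hf ⟨i, by omega⟩)

end ModifiedField

end

theorem theorem1 :
    ∃ C : ℕ → DerivExpr, (∀ p, DerivExpr.IsNonPrincipal (C p)) ∧
      ∀ (n D : ℕ) (E : Param D → ℝ), ContDiff ℝ ∞ E →
        (∃! f : Fin (n + 1) → Param D → Param D, IsModifiedField n E f) ∧
        ∀ f : Fin (n + 1) → Param D → Param D, IsModifiedField n E f →
          ∀ (h : ℝ) (θ : Param D),
            truncatedField f h θ =
              (∑ p ∈ Finset.range (n + 1),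
                (-1 / ((p : ℝ) + 1)) • h ^ p • (hessian E θ ^ p) (gradient E θ)) +
              (∑ p ∈ Finset.range (n + 1), h ^ p • DerivExpr.eval E (C p) θ) := by
  refine ⟨DerivExpr.correction, DerivExpr.isNonPrincipal_correction, fun n D E hE => ⟨?_, ?_⟩⟩
  · refine ⟨fun p => DerivExpr.evalₗ E (DerivExpr.modified p),
      (isModifiedField_iff_eq hE).2 fun _ => rfl,
      fun f hf => funext ((isModifiedField_iff_eq hE).1 hf)⟩
  · intro f hf h θ
    rw [truncatedField, ← Finset.sum_add_distrib, ← Fin.sum_univ_eq_sum_range fun p =>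
      (-1 / ((p : ℝ) + 1)) • h ^ p • (hessian E θ ^ p) (gradient E θ) +
        h ^ p • DerivExpr.eval E (DerivExpr.correction p) θ]
    refine Finset.sum_congr rfl fun p _ => ?_
    rw [(isModifiedField_iff_eq hE).1 hf p, DerivExpr.evalₗ_modified_apply, smul_add, smul_comm]
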